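/- Theorem. For finite sets $A,B\subset\mathbb{Z}$ write $A\pm B=\{a\pm b: a\in A,\ b\in B\}$. For a real number $K>1$, call a real number $\theta$ admissible if there is a constant $c>0$ (which may depend on $K$ and $\theta$) such that there are finite sets $A,B$ of integers with $B$ non-empty and $|A|$ arbitrarily large satisfying $$|A+B|\le K|A| \quad\text{and}\quad |A-B|\ge c\,|A+B|^{\theta}.$$ Let $\theta(K)$ denote the supremum of all admissible $\theta$ (the Gyarmati–Hennecart–Ruzsa sums-and-differences exponent). Then for every $K>1$ the number $1.173050$ is admissible, the set of admissible $\theta$ is bounded above, and consequently $$\theta(K)\ge 1.173050 .$$ -/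

import Mathlib

open scoped Pointwise

/-- `IsAdmissibleExponent K θ`: for some constant `c > 0` (which may depend on `K` and `θ`) there are
finite sets `A`, `B` of integers with `B` non-empty and `|A|` arbitrarily large such that
`|A + B| ≤ K |A|` and `|A - B| ≥ c |A + B| ^ θ`. -/
def IsAdmissibleExponent (K θ : ℝ) : Prop :=
  ∃ c : ℝ, 0 < c ∧ ∀ N : ℕ, ∃ A B : Finset ℤ,
    N ≤ A.card ∧ B.Nonempty ∧
    ((A + B).card : ℝ) ≤ K * (A.card : ℝ) ∧
    c * ((A + B).card : ℝ) ^ θ ≤ ((A - B).card : ℝ)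

/-- The sums-and-differences constant for the doubling parameter `K`: the supremum of all
admissible exponents. -/
noncomputable def sumDiffExponent (K : ℝ) : ℝ :=
  sSup {θ : ℝ | IsAdmissibleExponent K θ}

/-!
The upper bound is trivial: `|A - B| ≤ |A| |B| ≤ |A + B| ^ 2`, so no exponent above `2` is
admissible.

For the lower bound, suppose `U, W ⊆ [0, Q)` are sets of integers with
`|U - W| ≥ Q ^ (θ - 1) |U + W|`. Let `A` be the union of an interval of length `M Q` and of about
`2 Q / |U + W|` widely spaced translates of `U`, and let `B = W`. The sum `A + B` has at most
`(M + 3) Q` elements, since all translates of `U + W` together have only `O(Q)` elements, while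
`A - B` contains disjoint translates of `U - W`, hence at least `Q ^ θ` elements. Thus `θ` is
admissible for every `K ≥ (M + 3) / M` (`isAdmissibleExponent_of_dense_differences`).

The sets `U, W` are images under base-`(2n + 1)` expansion of sets of digit vectors
`V₁, V₂ ⊆ {0, …, n} ^ m` with prescribed digit sums `p` and `q`. For the choice of `p` and `q`,
give a vector `d ∈ {-n, …, n} ^ m` the weight `u ^ ‖d‖₁`; the total weight is `G ^ m` with
`G = ∑ u ^ |j|` over `|j| ≤ n`. Writing `d = d⁺ - d⁻`, the pair of digit sums of `d⁺` and `d⁻`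
takes at most `(m n + 1) ^ 2` values, so some value `(p, q)` carries weight at least
`G ^ m / (m n + 1) ^ 2`, whence `|V₁ - V₂| u ^ (p + q) ≥ G ^ m / (m n + 1) ^ 2`. On the other side
`|V₁ + V₂| u ^ (p + q) ≤ S ^ m` with `S = ∑ u ^ i` over `0 ≤ i ≤ 2 n`, because `V₁ + V₂` consists
of vectors in `{0, …, 2 n} ^ m` with digit sum `p + q`. The powers of `u` cancel in the quotient
(`exists_digit_sets`), and letting `m → ∞` shows that every `θ` with
`(2 n + 1) ^ (θ - 1) < G / S` is admissible (`isAdmissibleExponent_of_rpow_lt`). For `n = 5` and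
`u = 313 / 500`, which nearly maximizes `G / S`, one has `(G / S) ^ 52 > 11 ^ 9`, and
`9 / 52 > 0.17305`.
-/

open Finset

/-! ### Exponents above two are not admissible -/

theorem IsAdmissibleExponent.le_two {K θ : ℝ} (h : IsAdmissibleExponent K θ) : θ ≤ 2 := by
  obtain ⟨c, hc, h⟩ := h
  by_contra! hθ
  -- If `θ > 2`, then `c s ^ (θ - 2) ≤ 1` for arbitrarily large `s = |A + B|`.
  have ht : Filter.Tendsto (fun n : ℕ => c * (n : ℝ) ^ (θ - 2)) Filter.atTop Filter.atTop :=
    ((tendsto_rpow_atTop (by linarith)).comp tendsto_natCast_atTop_atTop).const_mul_atTop hc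
  obtain ⟨N, hN⟩ := Filter.eventually_atTop.1 (ht.eventually_gt_atTop 1)
  obtain ⟨A, B, hA, hB, -, hAB⟩ := h (max N 1)
  have hApos : A.Nonempty := card_pos.1 (by omega)
  have h1 : A.card ≤ (A + B).card := card_le_card_add_right hB
  have h2 : B.card ≤ (A + B).card := card_le_card_add_left hApos
  have h3 : (A - B).card ≤ (A + B).card * (A + B).card :=
    card_sub_le.trans (Nat.mul_le_mul h1 h2)
  have hpos : (0 : ℝ) < (A + B).card := by
    have : 0 < (A + B).card := by omega
    exact_mod_cast this
  have h4 := hN (A + B).card (by omega)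
  have h5 : ((A + B).card : ℝ) ^ θ
      = ((A + B).card : ℝ) ^ (θ - 2) * ((A + B).card * (A + B).card) := by
    rw [← sq, ← Real.rpow_natCast, ← Real.rpow_add hpos]
    norm_num
  have h6 : ((A - B).card : ℝ) ≤ (A + B).card * (A + B).card := by exact_mod_cast h3
  rw [h5, ← mul_assoc] at hAB
  nlinarith [mul_pos hpos hpos]

/-! ### Spreading out a pair with many differences -/

/-- Translating a set in `(-Q, Q)` by multiples of `2 Q` gives disjoint copies. -/
theorem card_spread_translates {Q : ℕ} {D : Finset ℤ} (hD : D ⊆ Ioo (-(Q : ℤ)) Q) (k : ℕ) :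
    (D + (range k).image fun j : ℕ => 2 * (Q : ℤ) * j).card = D.card * k := by
  have hinj : Set.InjOn (fun x : ℤ × ℤ => x.1 + x.2)
      (D ×ˢ (range k).image fun j : ℕ => 2 * (Q : ℤ) * j : Finset (ℤ × ℤ)) := by
    rintro ⟨a, s⟩ ha ⟨b, t⟩ hb hab
    simp only [coe_product, Set.mem_prod, mem_coe, mem_image] at ha hb
    obtain ⟨ha, i, -, rfl⟩ := ha
    obtain ⟨hb, j, -, rfl⟩ := hb
    have ha := mem_Ioo.1 (hD ha)
    have hb := mem_Ioo.1 (hD hb)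
    have hab : a + 2 * (Q : ℤ) * i = b + 2 * (Q : ℤ) * j := hab
    have hQ : (0 : ℤ) < 2 * Q := by omega
    have h1 : (i : ℤ) = j := by
      have h2 : 2 * (Q : ℤ) * (i - j) < 2 * Q * 1 := by linarith
      have h3 : 2 * (Q : ℤ) * (j - i) < 2 * Q * 1 := by linarith
      have := lt_of_mul_lt_mul_left h2 hQ.le
      have := lt_of_mul_lt_mul_left h3 hQ.le
      omega
    rw [h1] at hab
    simp only [Prod.mk.injEq]
    exact ⟨by linarith, by rw [h1]⟩
  rcases D.eq_empty_or_nonempty with rfl | ⟨d, hd⟩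
  · simp
  have hQ : Q ≠ 0 := by
    have := mem_Ioo.1 (hD hd)
    omega
  change (image₂ (· + ·) D _).card = _
  rw [card_image₂_iff.2 (by simpa only [coe_product] using hinj), card_image_of_injective, card_range]
  intro i j hij
  simpa [hQ] using hij

/-- The pair realizing the exponent is `A = [0, M Q) ∪ (U + T)` and `B = W`, where `T` consists of
`⌊2 Q / |U + W|⌋` multiples of `2 Q`. -/
theorem isAdmissibleExponent_of_dense_differences {K θ : ℝ} (hK : 1 < K) (hθ : 0 ≤ θ)
    (h : ∀ N : ℕ, ∃ (Q : ℕ) (U W : Finset ℤ), N ≤ Q ∧ U.Nonempty ∧ W.Nonempty ∧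
      U ⊆ Ico 0 (Q : ℤ) ∧ W ⊆ Ico 0 (Q : ℤ) ∧
      (Q : ℝ) ^ (θ - 1) * (U + W).card ≤ (U - W).card) :
    IsAdmissibleExponent K θ := by
  obtain ⟨M, hM⟩ := exists_nat_gt (3 / (K - 1))
  have hMK : (M : ℝ) + 3 ≤ K * M := by
    have := (div_lt_iff₀ (by linarith)).1 hM
    linarith
  have hM0 : 0 < M := by
    have : (0 : ℝ) < M := (div_pos three_pos (sub_pos.2 hK)).trans hM
    exact_mod_cast this
  refine ⟨1 / ((M : ℝ) + 3) ^ θ, by positivity, fun N => ?_⟩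
  obtain ⟨Q, U, W, hNQ, hU, hW, hUQ, hWQ, hUW⟩ := h N
  have hQ : 0 < Q := by
    obtain ⟨x, hx⟩ := hU
    have := mem_Ico.1 (hUQ hx)
    omega
  set s := (U + W).card with hs
  have hs0 : 0 < s := card_pos.2 (hU.add hW)
  have hs2 : s ≤ 2 * Q := by
    have : U + W ⊆ Ico 0 (2 * Q : ℤ) := by
      intro x hx
      obtain ⟨a, ha, b, hb, rfl⟩ := mem_add.1 hx
      have := mem_Ico.1 (hUQ ha)
      have := mem_Ico.1 (hWQ hb)
      rw [mem_Ico]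
      omega
    have := card_le_card this
    rw [Int.card_Ico] at this
    omega
  set k := 2 * Q / s with hk
  have hks : k * s ≤ 2 * Q := Nat.div_mul_le_self _ _
  -- `⌊x⌋ ≥ x / 2` for `x = 2 Q / s ≥ 1`
  have hks' : Q ≤ k * s := by
    have h1 : 1 ≤ k := (Nat.one_le_div_iff hs0).2 hs2
    have h2 : 2 * Q < s * (k + 1) := by
      rw [hk]
      exact Nat.lt_mul_div_succ _ hs0
    nlinarith
  set T : Finset ℤ := (range k).image fun j : ℕ => 2 * (Q : ℤ) * j with hT
  have hTk : T.card ≤ k := card_image_le.trans (card_range k).le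
  set I : Finset ℤ := Ico 0 ((M * Q : ℕ) : ℤ) with hI
  have hIA : M * Q ≤ (I ∪ (U + T)).card := by
    have h1 : I.card = M * Q := by rw [hI, Int.card_Ico, sub_zero, Int.toNat_natCast]
    exact h1.symm.le.trans (card_le_card subset_union_left)
  have hsum : (I ∪ (U + T) + W).card ≤ (M + 3) * Q := by
    have h1 : I + W ⊆ Ico 0 (((M + 1) * Q : ℕ) : ℤ) := by
      intro x hx
      obtain ⟨a, ha, b, hb, rfl⟩ := mem_add.1 hx
      have := mem_Ico.1 ha
      have := mem_Ico.1 (hWQ hb)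
      rw [mem_Ico]
      push_cast at *
      constructor <;> linarith
    have h2 : (I + W).card ≤ (M + 1) * Q := by
      have := card_le_card h1
      rwa [Int.card_Ico, sub_zero, Int.toNat_natCast] at this
    have h3 : (U + T + W).card ≤ s * k := by
      rw [add_right_comm]
      exact card_add_le.trans (Nat.mul_le_mul_left _ hTk)
    rw [union_add]
    refine (card_union_le _ _).trans ?_
    nlinarith
  have hdiff : (U - W).card * k ≤ (I ∪ (U + T) - W).card := by
    rw [← card_spread_translates (Q := Q) (D := U - W) _ k]
    · refine card_le_card ?_
      rw [← hT, sub_add_eq_add_sub]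
      exact sub_subset_sub_right subset_union_right
    · intro x hx
      obtain ⟨a, ha, b, hb, rfl⟩ := mem_sub.1 hx
      have := mem_Ico.1 (hUQ ha)
      have := mem_Ico.1 (hWQ hb)
      rw [mem_Ioo]
      omega
  have hQr : (0 : ℝ) < Q := by exact_mod_cast hQ
  have hsum' : ((I ∪ (U + T) + W).card : ℝ) ≤ (M + 3) * Q := by exact_mod_cast hsum
  refine ⟨I ∪ (U + T), W, ?_, hW, ?_, ?_⟩
  · nlinarith
  · have hIA' : (M : ℝ) * Q ≤ (I ∪ (U + T)).card := by exact_mod_cast hIA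
    calc ((I ∪ (U + T) + W).card : ℝ) ≤ (M + 3) * Q := hsum'
      _ ≤ K * M * Q := by gcongr
      _ = K * (M * Q) := by ring
      _ ≤ _ := by gcongr
  · have hks'' : (Q : ℝ) ≤ k * s := by exact_mod_cast hks'
    have hdiff' : ((U - W).card : ℝ) * k ≤ (I ∪ (U + T) - W).card := by exact_mod_cast hdiff
    calc 1 / ((M : ℝ) + 3) ^ θ * ((I ∪ (U + T) + W).card : ℝ) ^ θ
        ≤ 1 / ((M : ℝ) + 3) ^ θ * ((M + 3) * Q) ^ θ := by gcongr
      _ = (Q : ℝ) ^ θ := by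
        rw [Real.mul_rpow (by positivity) (by positivity)]
        field_simp
      _ = (Q : ℝ) ^ (θ - 1) * Q := by
        rw [← Real.rpow_add_one hQr.ne']
        simp
      _ ≤ (Q : ℝ) ^ (θ - 1) * (k * s) := by gcongr
      _ = (Q : ℝ) ^ (θ - 1) * s * k := by ring
      _ ≤ (U - W).card * k := by gcongr
      _ ≤ _ := hdiff'

/-! ### Digit vectors with prescribed digit sum -/

/-- The vectors in `{0, …, n} ^ m` with coordinate sum `p`. -/
noncomputable def digitVectors (n m p : ℕ) : Finset (Fin m → ℤ) :=
  {x ∈ Fintype.piFinset fun _ => Icc (0 : ℤ) n | ∑ i, (x i).toNat = p}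

theorem sum_pow_sum_piFinset {m : ℕ} (s : Finset ℤ) (f : ℤ → ℕ) (u : ℝ) :
    ∑ x ∈ Fintype.piFinset fun _ : Fin m => s, u ^ ∑ i, f (x i) = (∑ j ∈ s, u ^ f j) ^ m := by
  simp_rw [← prod_pow_eq_pow_sum]
  rw [sum_prod_piFinset s fun _ j => u ^ f j]
  simp

theorem card_add_digitVectors_le (n m p q : ℕ) {u : ℝ} (hu : 0 < u) :
    ((digitVectors n m p + digitVectors n m q).card : ℝ) * u ^ (p + q)
      ≤ (∑ j ∈ Icc (0 : ℤ) (2 * n), u ^ j.toNat) ^ m := by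
  rw [← sum_pow_sum_piFinset, ← nsmul_eq_mul, ← sum_const]
  have key : ∀ x ∈ digitVectors n m p + digitVectors n m q,
      (∑ i, (x i).toNat = p + q) ∧ x ∈ Fintype.piFinset fun _ : Fin m => Icc (0 : ℤ) (2 * n) := by
    intro x hx
    obtain ⟨a, ha, b, hb, rfl⟩ := mem_add.1 hx
    simp only [digitVectors, mem_filter, Fintype.mem_piFinset, mem_Icc] at ha hb
    constructor
    · rw [← ha.2, ← hb.2, ← sum_add_distrib]
      refine sum_congr rfl fun i _ => ?_
      exact Int.toNat_add (ha.1 i).1 (hb.1 i).1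
    · simp only [Fintype.mem_piFinset, mem_Icc, Pi.add_apply]
      intro i
      have := ha.1 i
      have := hb.1 i
      omega
  calc _ = ∑ x ∈ digitVectors n m p + digitVectors n m q, u ^ ∑ i, (x i).toNat :=
        sum_congr rfl fun x hx => by rw [(key x hx).1]
    _ ≤ _ := sum_le_sum_of_subset_of_nonneg (fun x hx => (key x hx).2) fun _ _ _ => by positivity

/-- Pigeonhole on the digit sums of the positive and negative parts of vectors in
`{-n, …, n} ^ m`: some pair of digit sums carries the average share of the total weight. -/
theorem exists_card_sub_digitVectors_ge (n m : ℕ) {u : ℝ} (hu : 0 < u) :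
    ∃ p q : ℕ, (digitVectors n m p).Nonempty ∧ (digitVectors n m q).Nonempty ∧
      (∑ j ∈ Icc (-n : ℤ) n, u ^ j.natAbs) ^ m
        ≤ (m * n + 1) ^ 2 * ((digitVectors n m p - digitVectors n m q).card * u ^ (p + q)) := by
  set E := Fintype.piFinset fun _ : Fin m => Icc (-n : ℤ) n with hE
  set P : (Fin m → ℤ) → ℕ := fun x => ∑ i, (x i).toNat with hP
  set R : (Fin m → ℤ) → ℕ := fun x => ∑ i, (-x i).toNat with hR
  have habs : ∀ x : Fin m → ℤ, ∑ i, (x i).natAbs = P x + R x := by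
    intro x
    rw [hP, hR, ← sum_add_distrib]
    exact sum_congr rfl fun i _ => (Int.toNat_add_toNat_neg_eq_natAbs _).symm
  set G := (∑ j ∈ Icc (-n : ℤ) n, u ^ j.natAbs) ^ m with hG
  have hGE : ∑ x ∈ E, u ^ (P x + R x) = G := by
    rw [hG, ← sum_pow_sum_piFinset]
    exact sum_congr rfl fun x _ => by rw [habs]
  have hG0 : 0 < G := pow_pos (sum_pos (fun _ _ => by positivity) ⟨0, by simp⟩) m
  have hmaps : ∀ x ∈ E, (P x, R x) ∈ range (m * n + 1) ×ˢ range (m * n + 1) := by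
    intro x hx
    have hx : ∀ i, -(n : ℤ) ≤ x i ∧ x i ≤ n := by simpa [hE] using hx
    have h1 : P x ≤ ∑ _i : Fin m, n := sum_le_sum fun i _ => by have := hx i; omega
    have h2 : R x ≤ ∑ _i : Fin m, n := sum_le_sum fun i _ => by have := hx i; omega
    simp only [sum_const, card_univ, Fintype.card_fin, smul_eq_mul] at h1 h2
    simp only [mem_product, mem_range]
    omega
  obtain ⟨⟨p, q⟩, -, hpq⟩ := exists_le_sum_fiber_of_maps_to_of_nsmul_le_sum
    (w := fun x => u ^ (P x + R x)) (b := G / (m * n + 1) ^ 2) hmaps ⟨(0, 0), by simp⟩ (by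
      rw [hGE, card_product, card_range, nsmul_eq_mul]
      apply le_of_eq
      push_cast
      field_simp)
  set F := {x ∈ E | (P x, R x) = (p, q)} with hF
  have hsum : ∑ x ∈ F, u ^ (P x + R x) = F.card * u ^ (p + q) := by
    rw [← nsmul_eq_mul, ← sum_const]
    refine sum_congr rfl fun x hx => ?_
    have := (mem_filter.1 hx).2
    simp only [Prod.mk.injEq] at this
    rw [this.1, this.2]
  -- the positive and negative parts of a vector in `F`
  have hparts : ∀ x ∈ F, (fun i => max (x i) 0) ∈ digitVectors n m p ∧
      (fun i => max (-x i) 0) ∈ digitVectors n m q := by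
    intro x hx
    obtain ⟨hx, hxpq⟩ := mem_filter.1 hx
    simp only [Prod.mk.injEq] at hxpq
    have hx : ∀ i, -(n : ℤ) ≤ x i ∧ x i ≤ n := by simpa [hE] using hx
    simp only [digitVectors, mem_filter, Fintype.mem_piFinset, mem_Icc]
    refine ⟨⟨fun i => ?_, ?_⟩, fun i => ?_, ?_⟩
    · have := hx i
      omega
    · rw [← hxpq.1]
      exact sum_congr rfl fun i _ => by omega
    · have := hx i
      omega
    · rw [← hxpq.2]
      exact sum_congr rfl fun i _ => by omega
  have hFsub : F ⊆ digitVectors n m p - digitVectors n m q := by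
    intro x hx
    refine mem_sub.2 ⟨_, (hparts x hx).1, _, (hparts x hx).2, funext fun i => ?_⟩
    simp only [Pi.sub_apply]
    omega
  rw [hsum, div_le_iff₀ (by positivity)] at hpq
  have hFne : F.Nonempty := by
    by_contra hne
    rw [not_nonempty_iff_eq_empty.1 hne] at hpq
    simp only [card_empty, Nat.cast_zero, zero_mul] at hpq
    linarith
  obtain ⟨x, hx⟩ := hFne
  refine ⟨p, q, ⟨_, (hparts x hx).1⟩, ⟨_, (hparts x hx).2⟩, hpq.trans ?_⟩
  rw [mul_comm]
  gcongr

/-- With `G` and `S` the weighted sums on the two sides, `|V₁ - V₂| / |V₁ + V₂|` is at least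
`(G / S) ^ m / (m n + 1) ^ 2`. The digit sums `p` and `q` need not agree. -/
theorem exists_digit_sets (n m : ℕ) {u : ℝ} (hu : 0 < u) :
    ∃ p q : ℕ, (digitVectors n m p).Nonempty ∧ (digitVectors n m q).Nonempty ∧
      (∑ j ∈ Icc (-n : ℤ) n, u ^ j.natAbs) ^ m * (digitVectors n m p + digitVectors n m q).card
        ≤ (m * n + 1) ^ 2 * (∑ j ∈ Icc (0 : ℤ) (2 * n), u ^ j.toNat) ^ m *
          (digitVectors n m p - digitVectors n m q).card := by
  obtain ⟨p, q, hp, hq, h⟩ := exists_card_sub_digitVectors_ge n m hu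
  refine ⟨p, q, hp, hq, ?_⟩
  have h' := card_add_digitVectors_le n m p q hu
  refine (mul_le_mul_of_nonneg_right h (Nat.cast_nonneg _)).trans ?_
  calc _ = (m * n + 1 : ℝ) ^ 2 * (((digitVectors n m p + digitVectors n m q).card : ℝ)
          * u ^ (p + q)) * (digitVectors n m p - digitVectors n m q).card := by ring
    _ ≤ _ := by gcongr

/-! ### Expansion in a fixed base -/

/-- The value `∑ i, x i * b ^ i` of a digit vector in base `b`, as an additive homomorphism. The
digits may be arbitrary integers. -/
def baseValue (b : ℤ) (m : ℕ) : (Fin m → ℤ) →+ ℤ where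
  toFun x := ∑ i, x i * b ^ (i : ℕ)
  map_zero' := by simp
  map_add' x y := by simp [add_mul, sum_add_distrib]

theorem baseValue_succ (b : ℤ) {m : ℕ} (x : Fin (m + 1) → ℤ) :
    baseValue b (m + 1) x = x 0 + b * baseValue b m (fun i => x i.succ) := by
  simp only [baseValue, AddMonoidHom.coe_mk, ZeroHom.coe_mk, Fin.sum_univ_succ, mul_sum]
  simp only [Fin.val_zero, pow_zero, mul_one, Fin.val_succ, pow_succ]
  congr 1
  exact sum_congr rfl fun i _ => by ring

theorem baseValue_nonneg_lt {b : ℤ} {m : ℕ} {x : Fin m → ℤ} (hx : ∀ i, 0 ≤ x i ∧ x i < b) :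
    0 ≤ baseValue b m x ∧ baseValue b m x < b ^ m := by
  induction m with
  | zero => simp [baseValue]
  | succ m ih =>
    have h := ih fun i => hx i.succ
    have h0 := hx 0
    rw [baseValue_succ, pow_succ]
    constructor <;> nlinarith

/-- Digits of absolute value less than `b` suffice here: differences of two digit vectors with
entries in `[-n, n]` have this form for `b = 2 n + 1`. -/
theorem eq_zero_of_baseValue_eq_zero {b : ℤ} {m : ℕ} {x : Fin m → ℤ} (hx : ∀ i, |x i| < b)
    (h : baseValue b m x = 0) : x = 0 := by
  induction m with
  | zero => exact Subsingleton.elim _ _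
  | succ m ih =>
    rw [baseValue_succ] at h
    have h0 : x 0 = 0 :=
      Int.eq_zero_of_abs_lt_dvd ⟨-baseValue b m fun i => x i.succ, by linarith⟩ (hx 0)
    have hb : b ≠ 0 := by
      have := (abs_nonneg (x 0)).trans_lt (hx 0)
      omega
    have h1 := ih (fun i => hx i.succ) (by simpa [h0, hb] using h)
    funext i
    refine Fin.cases h0 (fun j => ?_) i
    exact congrFun h1 j

theorem baseValue_injOn_sub_digitVectors (n m p q : ℕ) :
    Set.InjOn (baseValue (2 * n + 1) m) (digitVectors n m p - digitVectors n m q : Finset _) := by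
  have hbd : ∀ x ∈ digitVectors n m p - digitVectors n m q, ∀ i, -(n : ℤ) ≤ x i ∧ x i ≤ n := by
    intro x hx i
    obtain ⟨a, ha, b, hb, rfl⟩ := mem_sub.1 hx
    simp only [digitVectors, mem_filter, Fintype.mem_piFinset, mem_Icc] at ha hb
    have := ha.1 i
    have := hb.1 i
    simp only [Pi.sub_apply]
    omega
  intro x hx y hy hxy
  refine sub_eq_zero.1 (eq_zero_of_baseValue_eq_zero (b := 2 * n + 1) (fun i => ?_) ?_)
  · have := hbd x hx i
    have := hbd y hy i
    rw [Pi.sub_apply, abs_lt]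
    omega
  · rw [map_sub, hxy, sub_self]

theorem image_digitVectors_subset (n m p : ℕ) :
    (digitVectors n m p).image (baseValue (2 * n + 1) m) ⊆ Ico 0 (((2 * n + 1) ^ m : ℕ) : ℤ) := by
  intro y hy
  obtain ⟨x, hx, rfl⟩ := mem_image.1 hy
  simp only [digitVectors, mem_filter, Fintype.mem_piFinset, mem_Icc] at hx
  rw [mem_Ico]
  push_cast
  exact baseValue_nonneg_lt fun i => by have := hx.1 i; omega

/-! ### Admissible exponents from digit vectors -/

theorem isAdmissibleExponent_of_rpow_lt {K θ u : ℝ} (hK : 1 < K) (hθ : 0 ≤ θ) (hu : 0 < u)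
    {n : ℕ} (hn : 0 < n)
    (h : (2 * n + 1 : ℝ) ^ (θ - 1) * ∑ j ∈ Icc (0 : ℤ) (2 * n), u ^ j.toNat
      < ∑ j ∈ Icc (-n : ℤ) n, u ^ j.natAbs) :
    IsAdmissibleExponent K θ := by
  set S := ∑ j ∈ Icc (0 : ℤ) (2 * n), u ^ j.toNat with hS
  set G := ∑ j ∈ Icc (-n : ℤ) n, u ^ j.natAbs with hG
  have hS0 : 0 < S := sum_pos (fun _ _ => by positivity) ⟨0, by simp⟩
  set β := (2 * n + 1 : ℝ) ^ (θ - 1) with hβ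
  have hβ0 : 0 < β := by positivity
  -- The exponential gain `(G / (β S)) ^ m` beats the polynomial loss `(m n + 1) ^ 2`.
  have hev : ∀ᶠ m : ℕ in Filter.atTop, ((m : ℝ) * n + 1) ^ 2 * (β * S) ^ m ≤ G ^ m := by
    have hr : 1 < G / (β * S) := (one_lt_div (by positivity)).2 h
    have ht := (tendsto_pow_const_div_const_pow_of_one_lt 2 hr).eventually
      (gt_mem_nhds (show (0 : ℝ) < 1 / (n + 1) ^ 2 by positivity))
    filter_upwards [ht, Filter.eventually_ge_atTop 1] with m hm hm1
    have hm1 : (1 : ℝ) ≤ m := by exact_mod_cast hm1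
    rw [div_lt_div_iff₀ (by positivity) (by positivity), one_mul, div_pow,
      lt_div_iff₀ (by positivity)] at hm
    refine le_trans ?_ hm.le
    rw [← mul_pow]
    gcongr
    nlinarith
  refine isAdmissibleExponent_of_dense_differences hK hθ fun N => ?_
  obtain ⟨m, hm, hmN⟩ := (hev.and (Filter.eventually_ge_atTop N)).exists
  obtain ⟨p, q, hp, hq, hpq⟩ := exists_digit_sets n m hu
  refine ⟨(2 * n + 1) ^ m, (digitVectors n m p).image (baseValue (2 * n + 1) m),
    (digitVectors n m q).image (baseValue (2 * n + 1) m), ?_, hp.image _, hq.image _,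
    image_digitVectors_subset n m p, image_digitVectors_subset n m q, ?_⟩
  · exact hmN.trans (Nat.lt_pow_self (by omega)).le
  · have himg : (digitVectors n m p).image (baseValue (2 * n + 1) m)
        - (digitVectors n m q).image (baseValue (2 * n + 1) m)
        = (digitVectors n m p - digitVectors n m q).image (baseValue (2 * n + 1) m) :=
      (image_image₂_distrib (map_sub _)).symm
    rw [← image_add, himg, card_image_of_injOn (baseValue_injOn_sub_digitVectors n m p q)]
    have hc : (((digitVectors n m p + digitVectors n m q).image
        (baseValue (2 * n + 1) m)).card : ℝ) ≤ (digitVectors n m p + digitVectors n m q).card := by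
      exact_mod_cast card_image_le
    have hQ : (((2 * n + 1) ^ m : ℕ) : ℝ) ^ (θ - 1) = β ^ m := by
      push_cast
      rw [hβ, ← Real.rpow_natCast, ← Real.rpow_natCast, ← Real.rpow_mul (by positivity),
        ← Real.rpow_mul (by positivity), mul_comm (m : ℝ)]
    rw [hQ]
    refine (mul_le_mul_of_nonneg_left hc (by positivity)).trans ?_
    set s : ℝ := ((digitVectors n m p + digitVectors n m q).card : ℝ)
    refine le_of_mul_le_mul_left (a := ((m : ℝ) * n + 1) ^ 2 * S ^ m) ?_ (by positivity)
    calc ((m : ℝ) * n + 1) ^ 2 * S ^ m * (β ^ m * s)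
        = ((m : ℝ) * n + 1) ^ 2 * (β * S) ^ m * s := by ring
      _ ≤ G ^ m * s := by gcongr
      _ ≤ _ := hpq

theorem isAdmissibleExponent_of_base_eleven {K : ℝ} (hK : 1 < K) :
    IsAdmissibleExponent K 1.173050 := by
  refine isAdmissibleExponent_of_rpow_lt (u := 313 / 500) (n := 5) hK (by norm_num) (by norm_num)
    (by norm_num) ?_
  have habs : ∑ j ∈ Icc (0 : ℤ) (2 * (5 : ℕ)), (313 / 500 : ℝ) ^ j.toNat
      = ∑ j ∈ Icc (0 : ℤ) (2 * (5 : ℕ)), (313 / 500 : ℝ) ^ j.natAbs := by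
    refine sum_congr rfl fun j hj => ?_
    have := mem_Icc.1 hj
    congr 1
    omega
  have hS : Icc (0 : ℤ) (2 * (5 : ℕ)) = {0, 1, 2, 3, 4, 5, 6, 7, 8, 9, 10} := by decide
  have hG : Icc (-(5 : ℕ) : ℤ) (5 : ℕ) = {-5, -4, -3, -2, -1, 0, 1, 2, 3, 4, 5} := by decide
  rw [habs, hS, hG, ← lt_div_iff₀ (by norm_num)]
  have h11 : ((2 * (5 : ℕ) + 1 : ℝ)) = 11 := by norm_num
  rw [h11]
  -- `9 / 52` lies between `0.17305` and `log (G / S) / log 11 = 0.1730772…`, and its small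
  -- denominator keeps the integer powers to be compared short.
  calc (11 : ℝ) ^ ((1.173050 : ℝ) - 1) < 11 ^ ((9 : ℝ) / 52) :=
        Real.rpow_lt_rpow_of_exponent_lt (by norm_num) (by norm_num)
    _ = ((11 : ℝ) ^ 9) ^ ((52 : ℝ)⁻¹) := by
        rw [← Real.rpow_natCast, ← Real.rpow_mul (by norm_num)]
        norm_num
    _ ≤ _ := by
        rw [Real.rpow_inv_le_iff_of_pos (by norm_num) _ (by norm_num)]
        · rw [show (52 : ℝ) = ((52 : ℕ) : ℝ) by norm_num, Real.rpow_natCast]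
          norm_num
        · norm_num

theorem mainTheorem1 (K : ℝ) (hK : 1 < K) :
    IsAdmissibleExponent K 1.173050 ∧
      BddAbove {θ : ℝ | IsAdmissibleExponent K θ} ∧
      1.173050 ≤ sumDiffExponent K := by
  have hbdd : BddAbove {θ : ℝ | IsAdmissibleExponent K θ} := ⟨2, fun _ h => h.le_two⟩
  have hadm := isAdmissibleExponent_of_base_eleven hK
  exact ⟨hadm, hbdd, le_csSup hbdd hadm⟩
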